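/- Let $\Delta=\{z\in\mathbb C:|z|<1\}$. For a weight $v$ on $\Delta$ (a continuous, bounded, strictly positive function), let $\mathcal H_v(\Delta)$ be the space of all holomorphic $f:\Delta\to\mathbb C$ with $\|f\|_v:=\sup_{z\in\Delta}v(z)|f(z)|<\infty$, and let $\mathcal H_{v_o}(\Delta)$ be its subspace, with the same norm, of those $f$ such that for every $\varepsilon>0$ there is a compact set $K\subset\Delta$ with $v(z)|f(z)|<\varepsilon$ for all $z\in\Delta\setminus K$. Theorem 5.5. Let $v(z)=1-|z|$ and $w(z)=1-|z|^2$ on $\Delta$. (i) The map $S(f)(z)=f(z^2)$ is a non-surjective linear isometry from $\mathcal H_{v_o}(\Delta)$ into $\mathcal H_{w_o}(\Delta)$. (ii) For every (complex) linear isometry $T:\mathcal H_{v_o}(\Delta)\to\mathcal H_{w_o}(\Delta)$, not assumed surjective, there are a constant $c\in\mathbb C$ with $|c|=1$ and an automorphism $\psi$ of $\Delta$ (a biholomorphic map of $\Delta$ onto itself) such that $$T(f)(z)=c\,\psi'(z)\,f(\psi(z)^2)\qquad\text{for all } f\in\mathcal H_{v_o}(\Delta),\ z\in\Delta .$$ That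 is, $T(f)=c\,\psi'\cdot\big(S(f)\circ\psi\big)$. -/

import Mathlib

noncomputable section

/-- A weight on `U`: a continuous, bounded, strictly positive real function on `U`. -/
structure Weight (U : Set ℂ) where
  toFun : U → ℝ
  continuous_toFun : Continuous toFun
  bounded_toFun : BddAbove (Set.range toFun)
  pos : ∀ z, 0 < toFun z

instance (U : Set ℂ) : CoeFun (Weight U) (fun _ => U → ℝ) := ⟨Weight.toFun⟩

/-- Extension by zero of a function on `U`; only its values on `U` matter below, as `U` is open. -/
def extendZero {U : Set ℂ} (f : U → ℂ) : ℂ → ℂ := Function.extend Subtype.val f 0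

theorem extendZero_apply {U : Set ℂ} (f : U → ℂ) (z : U) : extendZero f z = f z :=
  Subtype.val_injective.extend_apply f 0 z

/-- `f` is holomorphic on the open set `U`. -/
def IsHolomorphic {U : Set ℂ} (f : U → ℂ) : Prop := DifferentiableOn ℂ (extendZero f) U

/-- The complex derivative of a holomorphic function `f` on the open set `U`, at a point of `U`. -/
def holDeriv {U : Set ℂ} (f : U → ℂ) (z : U) : ℂ := deriv (extendZero f) (z : ℂ)

variable {U : Set ℂ}

theorem IsHolomorphic.congr_ext {f : U → ℂ} {g : ℂ → ℂ} (hg : DifferentiableOn ℂ g U)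
    (h : ∀ z : U, f z = g z) : IsHolomorphic f :=
  DifferentiableOn.congr hg fun z hz => (extendZero_apply f ⟨z, hz⟩).trans (h ⟨z, hz⟩)

/-- The vector space underlying `H_v(U)`: the holomorphic functions `f` on `U` for which
`v |f|` is bounded. -/
def weightedSubmodule (v : Weight U) : Submodule ℂ (U → ℂ) where
  carrier := {f | IsHolomorphic f ∧ BddAbove (Set.range fun z => v z * ‖f z‖)}
  zero_mem' := by
    refine ⟨IsHolomorphic.congr_ext (g := 0) (differentiableOn_const 0) fun z => rfl, 0, ?_⟩
    rintro _ ⟨z, rfl⟩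
    simp
  add_mem' := by
    rintro f g ⟨hf, A, hA⟩ ⟨hg, B, hB⟩
    refine ⟨IsHolomorphic.congr_ext (hf.add hg) fun z => by simp [extendZero_apply],
      A + B, ?_⟩
    rintro _ ⟨z, rfl⟩
    have h1 := hA ⟨z, rfl⟩
    have h2 := hB ⟨z, rfl⟩
    have h3 := mul_le_mul_of_nonneg_left (norm_add_le (f z) (g z)) (v.pos z).le
    simp only [Pi.add_apply] at *
    linarith
  smul_mem' := by
    rintro c f ⟨hf, A, hA⟩
    refine ⟨IsHolomorphic.congr_ext (hf.const_smul c) fun z => by simp [extendZero_apply],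
      ‖c‖ * A, ?_⟩
    rintro _ ⟨z, rfl⟩
    have h1 := mul_le_mul_of_nonneg_left (hA ⟨z, rfl⟩) (norm_nonneg c)
    simp only [Pi.smul_apply, smul_eq_mul, norm_mul] at *
    linarith

/-- The weighted space `H_v(U)`. It is a type of its own, so that it carries only the topology
of its norm and not that of pointwise convergence. -/
def WeightedH (v : Weight U) : Type := weightedSubmodule v

instance (v : Weight U) : AddCommGroup (WeightedH v) := inferInstanceAs (AddCommGroup (weightedSubmodule v))

instance (v : Weight U) : Module ℂ (WeightedH v) := inferInstanceAs (Module ℂ (weightedSubmodule v))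

instance (v : Weight U) : CoeFun (WeightedH v) (fun _ => U → ℂ) := ⟨fun f => f.1⟩

namespace WeightedH

variable {v : Weight U}

theorem add_apply (f g : WeightedH v) (z : U) : (f + g) z = f z + g z := rfl

theorem neg_apply (f : WeightedH v) (z : U) : (-f) z = -f z := rfl

theorem zero_apply (z : U) : (0 : WeightedH v) z = 0 := rfl

theorem smul_apply (c : ℂ) (f : WeightedH v) (z : U) : (c • f) z = c * f z := rfl

/-- The norm `‖f‖_v = sup_{z ∈ U} v(z) |f(z)|`. -/
instance : Norm (WeightedH v) := ⟨fun f => ⨆ z, v z * ‖f z‖⟩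

theorem norm_def (f : WeightedH v) : ‖f‖ = ⨆ z, v z * ‖f z‖ := rfl

theorem le_norm (f : WeightedH v) (z : U) : v z * ‖f z‖ ≤ ‖f‖ := le_ciSup f.2.2 z

theorem norm_nonneg' (f : WeightedH v) : 0 ≤ ‖f‖ :=
  Real.iSup_nonneg fun z => mul_nonneg (v.pos z).le (norm_nonneg _)

theorem norm_le {f : WeightedH v} {C : ℝ} (hC : 0 ≤ C) (h : ∀ z, v z * ‖f z‖ ≤ C) : ‖f‖ ≤ C :=
  Real.iSup_le h hC

theorem core : NormedSpace.Core ℂ (WeightedH v) where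
  norm_nonneg := norm_nonneg'
  norm_smul c f := by
    rw [norm_def, norm_def, Real.mul_iSup_of_nonneg (norm_nonneg c)]
    congr 1
    funext z
    rw [smul_apply, norm_mul]
    ring
  norm_triangle f g := by
    refine norm_le (add_nonneg (norm_nonneg' f) (norm_nonneg' g)) fun z => ?_
    have h1 := le_norm f z
    have h2 := le_norm g z
    have h3 := mul_le_mul_of_nonneg_left (norm_add_le (f z) (g z)) (v.pos z).le
    rw [add_apply]
    linarith
  norm_eq_zero_iff f := by
    constructor
    · intro h
      refine Subtype.ext (funext fun z => ?_)
      have h1 := le_norm f z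
      rw [h] at h1
      have h2 : ‖f z‖ ≤ 0 := nonpos_of_mul_nonpos_right h1 (v.pos z)
      exact norm_le_zero_iff.mp h2
    · rintro rfl
      refine le_antisymm (norm_le le_rfl fun z => ?_) (norm_nonneg' 0)
      simp [zero_apply]

instance : NormedAddCommGroup (WeightedH v) := NormedAddCommGroup.ofCore core

instance : NormedSpace ℂ (WeightedH v) := NormedSpace.ofCore core

end WeightedH

/-- The subspace `H_{v_o}(U)` of `H_v(U)`, with the norm of `H_v(U)`: the functions `f` for which
`v |f|` tends to `0` at the boundary of `U`, that is, for every `ε > 0` there is a compact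
`K ⊆ U` with `v |f| < ε` on `U \ K`. -/
def LittleWeightedH (v : Weight U) : Submodule ℂ (WeightedH v) where
  carrier := {f | ∀ ε > 0, ∃ K : Set U, IsCompact K ∧ ∀ z ∉ K, v z * ‖f z‖ < ε}
  zero_mem' := fun ε hε => ⟨∅, isCompact_empty, fun z _ => by simpa [WeightedH.zero_apply] using hε⟩
  add_mem' := by
    intro f g hf hg ε hε
    obtain ⟨K, hK, hf⟩ := hf (ε / 2) (half_pos hε)
    obtain ⟨L, hL, hg⟩ := hg (ε / 2) (half_pos hε)
    refine ⟨K ∪ L, hK.union hL, fun z hz => ?_⟩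
    have h1 := hf z fun h => hz (Or.inl h)
    have h2 := hg z fun h => hz (Or.inr h)
    have h3 := mul_le_mul_of_nonneg_left (norm_add_le (f z) (g z)) (v.pos z).le
    rw [WeightedH.add_apply]
    linarith
  smul_mem' := by
    intro c f hf ε hε
    have hc : 0 < ‖c‖ + 1 := by positivity
    obtain ⟨K, hK, hf⟩ := hf (ε / (‖c‖ + 1)) (div_pos hε hc)
    refine ⟨K, hK, fun z hz => ?_⟩
    have h1 := (lt_div_iff₀ hc).mp (hf z hz)
    have h2 : 0 ≤ v z * ‖f z‖ := mul_nonneg (v.pos z).le (norm_nonneg _)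
    rw [WeightedH.smul_apply, norm_mul]
    linarith

instance (v : Weight U) : CoeFun (LittleWeightedH v) (fun _ => U → ℂ) := ⟨fun f => f.1.1⟩

/-- The open unit disc `Δ`. -/
abbrev unitDisc : Set ℂ := Metric.ball 0 1

theorem norm_lt_one_of_disc (z : unitDisc) : ‖(z : ℂ)‖ < 1 := mem_ball_zero_iff.mp z.2

/-- The weight `v(z) = 1 - |z|` on the disc. -/
def discWeight : Weight unitDisc where
  toFun z := 1 - ‖(z : ℂ)‖
  continuous_toFun := by fun_prop
  bounded_toFun := by
    refine ⟨1, ?_⟩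
    rintro _ ⟨z, rfl⟩
    simp
  pos z := sub_pos.mpr (norm_lt_one_of_disc z)

/-- The weight `w(z) = 1 - |z|^2` on the disc. -/
def discWeightSq : Weight unitDisc where
  toFun z := 1 - ‖(z : ℂ)‖ ^ 2
  continuous_toFun := by fun_prop
  bounded_toFun := by
    refine ⟨1, ?_⟩
    rintro _ ⟨z, rfl⟩
    simp
  pos z := sub_pos.mpr (pow_lt_one₀ (norm_nonneg _) (norm_lt_one_of_disc z) two_ne_zero)

/-- The squaring map `z ↦ z^2` of the disc into itself. -/
def discSq (z : unitDisc) : unitDisc :=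
  ⟨(z : ℂ) ^ 2, by
    rw [mem_ball_zero_iff, norm_pow]
    exact pow_lt_one₀ (norm_nonneg _) (norm_lt_one_of_disc z) two_ne_zero⟩

/-- An automorphism of the disc: a bijection of the disc onto itself that is holomorphic and has
a holomorphic inverse. -/
structure DiscAut extends unitDisc ≃ unitDisc where
  holomorphic_toFun : IsHolomorphic fun z => (toFun z : ℂ)
  holomorphic_invFun : IsHolomorphic fun z => (invFun z : ℂ)

instance : CoeFun DiscAut (fun _ => unitDisc → unitDisc) := ⟨fun ψ => ψ.toFun⟩

/-- The derivative `ψ'` of an automorphism `ψ` of the disc. -/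
def DiscAut.derivative (ψ : DiscAut) (z : unitDisc) : ℂ := holDeriv (fun u => (ψ u : ℂ)) z

end

open Filter Topology ComplexConjugate InnerProductSpace

/-!
Each point `p` of the disc is the strict peak of some `v |f|`, so the norm of `H_{v_o}` is smooth
at `f`, and evaluation at any maximum point `q` of `w |T f|` must satisfy `T g q = a * g p` for all
`g`, with `(1 - |q|²) |a| = 1 - |p|`. Since `p` is the value at `q` of the meromorphic function
`φ = T(id) / T(1)`, which maps nowhere dense sets to meagre ones, such `q` are dense in some open
set. By continuity `T g = T(1) * (g ∘ φ)` there, and `(1 - |z|²) |T(1)| = 1 - |φ|`.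

Writing `T(1) = g²` and `φ = ψ²`, this says that the maps `(g, ψ)` and `(1, z g)` into `ℂ²` have
the same norm. By polarisation (Calabi rigidity) they have the same Gram kernel:
`g(z) conj(g(w)) (1 - z conj(w)) = 1 - ψ(z) conj(ψ(w))`. Moving some `k` and its image `ψ(k)` to
`0` by Blaschke factors removes `g`: the two factors differ by a rotation, so `ψ` extends to an
automorphism of the disc. Then `g²` and `ψ'` transform the Bergman kernel in the same way and
differ by a unimodular constant, and the identity theorem carries the formula to the whole disc.
-/

noncomputable section

section Meagre

variable {X Y : Type*} [TopologicalSpace X] [TopologicalSpace Y]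

theorem isNowhereDense_preimage {f : X → Y} (hf : Continuous f) (hfo : IsOpenMap f) {s : Set Y}
    (hs : IsNowhereDense s) : IsNowhereDense (f ⁻¹' s) := by
  rw [IsNowhereDense, ← hfo.preimage_closure_eq_closure_preimage hf,
    ← hfo.preimage_interior_eq_interior_preimage hf, hs, Set.preimage_empty]

theorem isMeagre_image_of_locally [SecondCountableTopology X] {f : X → Y} {s : Set X}
    (h : ∀ x ∈ s, ∃ t ∈ 𝓝[s] x, IsMeagre (f '' t)) : IsMeagre (f '' s) := by
  choose! t ht hft using h
  obtain ⟨c, hcs, hc, hsc⟩ := TopologicalSpace.countable_cover_nhdsWithin ht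
  refine IsMeagre.mono (Set.image_mono hsc) ?_
  rw [Set.image_iUnion₂]
  exact isMeagre_biUnion hc fun x hx => hft x (hcs hx)

theorem isMeagre_image_of_isLocalHomeomorphOn [SecondCountableTopology X] {f : X → Y} {s : Set X}
    (hf : IsLocalHomeomorphOn f s) (hs : IsNowhereDense s) : IsMeagre (f '' s) := by
  refine isMeagre_image_of_locally fun x hx => ?_
  obtain ⟨e, hxe, rfl⟩ := hf x hx
  refine ⟨e.source ∩ s, inter_mem (nhdsWithin_le_nhds (e.open_source.mem_nhds hxe))
    self_mem_nhdsWithin, ?_⟩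
  rw [← Subtype.image_preimage_coe, Set.image_image]
  have hs' : IsNowhereDense ((↑) ⁻¹' s : Set e.source) :=
    isNowhereDense_preimage continuous_subtype_val e.open_source.isOpenMap_subtype_val hs
  exact (e.isOpenEmbedding_restrict.isInducing.isNowhereDense_image hs').isMeagre

theorem isMeagre_singleton [T1Space X] [PerfectSpace X] (x : X) : IsMeagre {x} :=
  (isClosed_singleton.isNowhereDense_iff.mpr (interior_singleton x)).isMeagre

theorem isMeagre_image_setOf_deriv_eq_zero {φ : ℂ → ℂ} {s : Set ℂ} (hφ : AnalyticOnNhd ℂ φ s) :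
    IsMeagre (φ '' {z ∈ s | deriv φ z = 0}) := by
  refine isMeagre_image_of_locally fun q hq => ?_
  suffices h : ∀ᶠ z in 𝓝[{z ∈ s | deriv φ z = 0}] q, φ z = φ q from
    ⟨_, h, (isMeagre_singleton (φ q)).mono (Set.image_subset_iff.mpr fun _ => id)⟩
  rcases (hφ q hq.1).deriv.eventually_eq_zero_or_eventually_ne_zero with h0 | h0
  · refine eventually_nhdsWithin_of_eventually_nhds ?_
    obtain ⟨r, hr, hball⟩ :=
      Metric.eventually_nhds_iff_ball.mp (h0.and (hφ q hq.1).eventually_analyticAt)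
    filter_upwards [Metric.ball_mem_nhds q hr] with z hz
    exact Metric.isOpen_ball.is_const_of_deriv_eq_zero (convex_ball q r).isPreconnected
      (fun w hw => (hball w hw).2.differentiableAt.differentiableWithinAt)
      (fun w hw => (hball w hw).1) hz (Metric.mem_ball_self hr)
  · filter_upwards [nhdsWithin_le_nhds (eventually_nhdsWithin_iff.mp h0), self_mem_nhdsWithin]
      with z hz hzs
    exact congrArg φ (not_not.mp fun hne => hz hne hzs.2)

theorem isMeagre_image_of_analyticOnNhd {φ : ℂ → ℂ} {s : Set ℂ} (hφ : AnalyticOnNhd ℂ φ s)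
    (hs : IsNowhereDense s) : IsMeagre (φ '' s) := by
  have hlocal : IsLocalHomeomorphOn φ {z ∈ s | deriv φ z ≠ 0} := fun z hz =>
    have hd := (hφ z hz.1).hasStrictDerivAt
    ⟨(hd.hasStrictFDerivAt_equiv hz.2).toOpenPartialHomeomorph φ,
      (hd.hasStrictFDerivAt_equiv hz.2).mem_toOpenPartialHomeomorph_source, rfl⟩
  refine ((isMeagre_image_setOf_deriv_eq_zero hφ).union
    (isMeagre_image_of_isLocalHomeomorphOn hlocal (hs.mono fun z hz => hz.1))).mono ?_
  rw [← Set.image_union]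
  exact Set.image_mono fun z hz => (em (deriv φ z = 0)).imp (⟨hz, ·⟩) (⟨hz, ·⟩)

end Meagre

section Calabi

variable {E E' : Type*} [NormedAddCommGroup E] [InnerProductSpace ℂ E]
  [NormedAddCommGroup E'] [InnerProductSpace ℂ E'] {f F : ℂ → E} {g G : ℂ → E'} {Ω : Set ℂ}

theorem fderiv_real_inner_apply {z : ℂ} (hf : DifferentiableAt ℂ f z)
    (hF : DifferentiableAt ℂ F z) (d : ℂ) :
    fderiv ℝ (fun z => ⟪f z, F z⟫_ℂ) z d =
      d * ⟪f z, deriv F z⟫_ℂ + conj d * ⟪deriv f z, F z⟫_ℂ := by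
  rw [((hf.hasDerivAt.hasFDerivAt.restrictScalars ℝ).inner ℂ
    (hF.hasDerivAt.hasFDerivAt.restrictScalars ℝ)).fderiv]
  simp [fderivInnerCLM_apply, inner_smul_left, inner_smul_right]

theorem hasDerivAt_inner_const_left {z : ℂ} (hF : DifferentiableAt ℂ F z) (c : E) :
    HasDerivAt (fun z => ⟪c, F z⟫_ℂ) ⟪c, deriv F z⟫_ℂ z :=
  (innerSL ℂ c).hasFDerivAt.comp_hasDerivAt z hF.hasDerivAt

theorem inner_deriv_eq_inner_deriv (hΩ : IsOpen Ω) (hf : DifferentiableOn ℂ f Ω)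
    (hF : DifferentiableOn ℂ F Ω) (hg : DifferentiableOn ℂ g Ω) (hG : DifferentiableOn ℂ G Ω)
    (h : ∀ z ∈ Ω, ⟪f z, F z⟫_ℂ = ⟪g z, G z⟫_ℂ) :
    ∀ z ∈ Ω, ⟪f z, deriv F z⟫_ℂ = ⟪g z, deriv G z⟫_ℂ := by
  intro z hz
  have hnhds : Ω ∈ 𝓝 z := hΩ.mem_nhds hz
  have hdir (d : ℂ) : d * ⟪f z, deriv F z⟫_ℂ + conj d * ⟪deriv f z, F z⟫_ℂ =
      d * ⟪g z, deriv G z⟫_ℂ + conj d * ⟪deriv g z, G z⟫_ℂ := by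
    rw [← fderiv_real_inner_apply (hf.differentiableAt hnhds) (hF.differentiableAt hnhds),
      ← fderiv_real_inner_apply (hg.differentiableAt hnhds) (hG.differentiableAt hnhds)]
    exact DFunLike.congr_fun (EventuallyEq.fderiv_eq (eventually_of_mem hnhds h)) d
  -- The directions `1` and `I` separate the complex linear part from the conjugate linear one.
  have hone := hdir 1
  have hI := hdir Complex.I
  simp only [map_one, one_mul, Complex.conj_I] at hone hI
  linear_combination hone / 2 - Complex.I / 2 * hI + (⟪f z, deriv F z⟫_ℂ - ⟪deriv f z, F z⟫_ℂ -
    ⟪g z, deriv G z⟫_ℂ + ⟪deriv g z, G z⟫_ℂ) / 2 * Complex.I_sq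

theorem iteratedDeriv_inner_sub_inner_eq_zero [CompleteSpace E] [CompleteSpace E'] (hΩ : IsOpen Ω)
    (hf : DifferentiableOn ℂ f Ω) (hF : DifferentiableOn ℂ F Ω) (hg : DifferentiableOn ℂ g Ω)
    (hG : DifferentiableOn ℂ G Ω) (h : ∀ z ∈ Ω, ⟪f z, F z⟫_ℂ = ⟪g z, G z⟫_ℂ) {w : ℂ} (hw : w ∈ Ω)
    (n : ℕ) : iteratedDeriv n (fun z => ⟪f w, F z⟫_ℂ - ⟪g w, G z⟫_ℂ) w = 0 := by
  induction n generalizing F G with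
  | zero => simpa [sub_eq_zero] using h w hw
  | succ n ih =>
    have hderiv : deriv (fun z => ⟪f w, F z⟫_ℂ - ⟪g w, G z⟫_ℂ) =ᶠ[𝓝 w]
        fun z => ⟪f w, deriv F z⟫_ℂ - ⟪g w, deriv G z⟫_ℂ := by
      filter_upwards [hΩ.mem_nhds hw] with z hz
      have hz' := hΩ.mem_nhds hz
      exact ((hasDerivAt_inner_const_left (hF.differentiableAt hz') (f w)).sub
        (hasDerivAt_inner_const_left (hG.differentiableAt hz') (g w))).deriv
    rw [iteratedDeriv_succ', hderiv.iteratedDeriv_eq]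
    exact ih (hF.deriv hΩ) (hG.deriv hΩ) (inner_deriv_eq_inner_deriv hΩ hf hF hg hG h)

theorem inner_eq_inner_of_norm_eq_norm [CompleteSpace E] [CompleteSpace E'] (hΩ : IsOpen Ω)
    (hΩ' : IsPreconnected Ω) (hf : DifferentiableOn ℂ f Ω) (hg : DifferentiableOn ℂ g Ω)
    (h : ∀ z ∈ Ω, ‖f z‖ = ‖g z‖) {z w : ℂ} (hz : z ∈ Ω) (hw : w ∈ Ω) :
    ⟪f w, f z⟫_ℂ = ⟪g w, g z⟫_ℂ := by
  have hinner : ∀ z ∈ Ω, ⟪f z, f z⟫_ℂ = ⟪g z, g z⟫_ℂ := fun z hz => by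
    rw [inner_self_eq_norm_sq_to_K, inner_self_eq_norm_sq_to_K, h z hz]
  have han : AnalyticOnNhd ℂ (fun z => ⟪f w, f z⟫_ℂ - ⟪g w, g z⟫_ℂ) Ω :=
    (((innerSL ℂ (f w)).differentiable.comp_differentiableOn hf).sub
      ((innerSL ℂ (g w)).differentiable.comp_differentiableOn hg)).analyticOnNhd hΩ
  refine sub_eq_zero.mp (han.eqOn_zero_of_preconnected_of_eventuallyEq_zero hΩ' hw ?_ hz)
  refine analyticOrderAt_eq_top.mp (ENat.eq_top_iff_forall_ge.mpr fun n => ?_)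
  exact (natCast_le_analyticOrderAt_iff_iteratedDeriv_eq_zero (han w hw)).mpr fun i _ =>
    iteratedDeriv_inner_sub_inner_eq_zero hΩ hf hf hg hg hinner hw i

end Calabi

namespace IsHolomorphic

variable {U W : Set ℂ} {f g : U → ℂ}

theorem differentiableAt (hf : IsHolomorphic f) (hU : IsOpen U) (z : U) :
    DifferentiableAt ℂ (extendZero f) z :=
  DifferentiableOn.differentiableAt hf (hU.mem_nhds z.2)

theorem continuous (hf : IsHolomorphic f) : Continuous f :=
  (continuousOn_iff_continuous_domRestrict.mp (DifferentiableOn.continuousOn hf)).congr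
    fun z => extendZero_apply f z

theorem mul (hf : IsHolomorphic f) (hg : IsHolomorphic g) : IsHolomorphic fun z => f z * g z :=
  congr_ext (DifferentiableOn.mul hf hg) fun z => by simp [extendZero_apply]

theorem const_mul (hf : IsHolomorphic f) (c : ℂ) : IsHolomorphic fun z => c * f z :=
  congr_ext (DifferentiableOn.const_mul hf c) fun z => by simp [extendZero_apply]

theorem comp {σ : W → U} (hf : IsHolomorphic f) (hσ : IsHolomorphic fun z => (σ z : ℂ)) :
    IsHolomorphic fun z => f (σ z) := by
  refine congr_ext (DifferentiableOn.comp hf hσ fun z hz => ?_) fun z => ?_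
  · rw [extendZero_apply _ ⟨z, hz⟩]
    exact (σ ⟨z, hz⟩).2
  · rw [Function.comp_apply, extendZero_apply, extendZero_apply]

theorem eq_of_eventuallyEq (hf : IsHolomorphic f) (hg : IsHolomorphic g) (hU : IsOpen U)
    (hU' : IsPreconnected U) (q : U) (h : f =ᶠ[𝓝 q] g) : f = g := by
  have hext : extendZero f =ᶠ[𝓝 ↑q] extendZero g := by
    rw [← hU.isOpenEmbedding_subtypeVal.map_nhds_eq]
    exact h.mono fun z hz => (extendZero_apply f z).trans (hz.trans (extendZero_apply g z).symm)
  funext z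
  have := (DifferentiableOn.analyticOnNhd hf hU).eqOn_of_preconnected_of_eventuallyEq
    (DifferentiableOn.analyticOnNhd hg hU) hU' q.2 hext z.2
  rwa [extendZero_apply, extendZero_apply] at this

end IsHolomorphic

namespace LittleWeightedH

variable {U W : Set ℂ} {v : Weight U} {w : Weight W}

theorem isHolomorphic (f : LittleWeightedH v) : IsHolomorphic f := f.1.2.1

theorem le_norm (f : LittleWeightedH v) (z : U) : v z * ‖f z‖ ≤ ‖f‖ := WeightedH.le_norm f.1 z

theorem norm_le {f : LittleWeightedH v} {C : ℝ} (hC : 0 ≤ C) (h : ∀ z, v z * ‖f z‖ ≤ C) :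
    ‖f‖ ≤ C := WeightedH.norm_le (f := f.1) hC h

theorem add_apply (f g : LittleWeightedH v) (z : U) : (f + g) z = f z + g z := rfl

theorem smul_apply (c : ℂ) (f : LittleWeightedH v) (z : U) : (c • f) z = c * f z := rfl

theorem sub_apply (f g : LittleWeightedH v) (z : U) : (f - g) z = f z - g z := by
  simp only [sub_eq_add_neg]
  rfl

theorem continuous_weight_mul (f : LittleWeightedH v) : Continuous fun z => v z * ‖f z‖ :=
  v.continuous_toFun.mul (isHolomorphic f).continuous.norm

theorem tendsto_cocompact (f : LittleWeightedH v) :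
    Tendsto (fun z => v z * ‖f z‖) (cocompact U) (𝓝 0) := by
  refine tendsto_order.mpr ⟨fun a ha => .of_forall fun z =>
    ha.trans_le (mul_nonneg (v.pos z).le (norm_nonneg _)), fun ε hε => ?_⟩
  obtain ⟨K, hK, hfK⟩ := f.2 ε hε
  exact mem_cocompact.mpr ⟨K, hK, hfK⟩

/-- The member of the little weighted space given by a holomorphic function whose weighted modulus
tends to zero at the boundary. -/
def ofTendsto (f : U → ℂ) (hf : IsHolomorphic f)
    (h : Tendsto (fun z => v z * ‖f z‖) (cocompact U) (𝓝 0)) : LittleWeightedH v where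
  val := ⟨f, hf, ZeroAtInftyContinuousMap.isBounded_range
    ⟨⟨_, v.continuous_toFun.mul hf.continuous.norm⟩, h⟩ |>.bddAbove⟩
  property _ hε := mem_cocompact.mp (h.eventually_lt_const hε)

/-- The restriction to a bounded set `U` of an entire function, for a weight that vanishes at the
boundary of `U`. -/
def ofEntire (hU : Bornology.IsBounded U) (hv : Tendsto v (cocompact U) (𝓝 0)) (F : ℂ → ℂ)
    (hF : Differentiable ℂ F) : LittleWeightedH v :=
  ofTendsto (fun z => F z) (.congr_ext hF.differentiableOn fun _ => rfl) <| by
    obtain ⟨C, hC⟩ := hU.isCompact_closure.exists_bound_of_continuousOn hF.continuous.continuousOn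
    refine squeeze_zero (fun z => mul_nonneg (v.pos z).le (norm_nonneg _))
      (fun z => mul_le_mul_of_nonneg_left (hC z (subset_closure z.2)) (v.pos z).le) ?_
    simpa only [zero_mul] using hv.mul_const C

/-- Composition with a proper holomorphic surjection `σ` of `W` onto `U`, which is isometric for
the weight `v ∘ σ` on `W`. -/
def pullback (σ : W → U) (hσ : IsHolomorphic fun z => (σ z : ℂ))
    (hproper : Tendsto σ (cocompact W) (cocompact U)) (hsurj : Function.Surjective σ)
    (hw : ∀ z, v (σ z) = w z) : LittleWeightedH v →ₗᵢ[ℂ] LittleWeightedH w where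
  toFun f := ofTendsto (fun z => f (σ z)) ((isHolomorphic f).comp hσ) <|
    ((tendsto_cocompact f).comp hproper).congr fun z => by rw [Function.comp_apply, hw]
  map_add' _ _ := rfl
  map_smul' _ _ := rfl
  norm_map' f := by
    change ⨆ z, w z * ‖f (σ z)‖ = ⨆ z, v z * ‖f z‖
    simp only [← hw]
    exact hsurj.iSup_comp fun z => v z * ‖f z‖

theorem exists_isMaxOn (f : LittleWeightedH v) {A : Set U} (hA : IsClosed A) (hne : A.Nonempty) :
    ∃ x ∈ A, IsMaxOn (fun z => v z * ‖f z‖) A x := by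
  by_cases! h : ∃ x ∈ A, 0 < v x * ‖f x‖
  · obtain ⟨x, hx, hpos⟩ := h
    refine (continuous_weight_mul f).continuousOn.exists_isMaxOn' hA hx ?_
    exact ((tendsto_cocompact f).eventually_le_const hpos).filter_mono inf_le_left
  · obtain ⟨x, hx⟩ := hne
    exact ⟨x, hx, fun z hz => (h z hz).trans (mul_nonneg (v.pos x).le (norm_nonneg _))⟩

theorem exists_norm_eq {f : LittleWeightedH v} (hf : f ≠ 0) : ∃ z, v z * ‖f z‖ = ‖f‖ := by
  obtain ⟨z, -⟩ : ∃ z, f z ≠ 0 := by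
    by_contra! h
    exact hf (Subtype.ext (Subtype.ext (funext h)))
  obtain ⟨x, -, hmax⟩ := exists_isMaxOn f isClosed_univ ⟨z, trivial⟩
  exact ⟨x, (le_norm f x).antisymm (norm_le (mul_nonneg (v.pos x).le (norm_nonneg _))
    fun z => hmax (Set.mem_univ z))⟩

/-- The weighted modulus of `f` has its strict maximum at `p`. -/
def PeaksAt (f : LittleWeightedH v) (p : U) : Prop :=
  ∀ z, z ≠ p → v z * ‖f z‖ < v p * ‖f p‖

namespace PeaksAt

variable {f : LittleWeightedH v} {p : U}

theorem norm_eq (h : PeaksAt f p) : ‖f‖ = v p * ‖f p‖ := by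
  refine le_antisymm (norm_le (mul_nonneg (v.pos p).le (norm_nonneg _)) fun z => ?_) (le_norm f p)
  rcases eq_or_ne z p with rfl | hz
  · exact le_rfl
  · exact (h z hz).le

theorem exists_lt_norm (h : PeaksAt f p) {A : Set U} (hA : IsClosed A) (hp : p ∉ A) :
    ∃ m < ‖f‖, ∀ z ∈ A, v z * ‖f z‖ ≤ m := by
  rcases A.eq_empty_or_nonempty with rfl | hne
  · exact ⟨‖f‖ - 1, sub_one_lt _, fun z hz => hz.elim⟩
  · obtain ⟨x, hx, hmax⟩ := exists_isMaxOn f hA hne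
    exact ⟨_, h.norm_eq ▸ h x (ne_of_mem_of_not_mem hx hp), hmax⟩

/-- The norm is differentiable at a peaking function, in directions that vanish at the peak. -/
theorem exists_norm_add_smul_le (h : PeaksAt f p) {g : LittleWeightedH v} (hg : g p = 0) {ε : ℝ}
    (hε : 0 < ε) : ∃ s > 0, ∀ c : ℂ, ‖c‖ = s → ‖f + c • g‖ ≤ ‖f‖ + s * ε := by
  obtain ⟨m, hm, hfm⟩ := h.exists_lt_norm (A := {z | ε ≤ v z * ‖g z‖})
    (isClosed_le continuous_const (continuous_weight_mul g)) (by simpa [hg] using hε)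
  have hg' : 0 < ‖g‖ + 1 := by positivity
  refine ⟨(‖f‖ - m) / (‖g‖ + 1), div_pos (sub_pos.mpr hm) hg', fun c hc => ?_⟩
  have hc' : ‖c‖ * ‖g‖ ≤ ‖f‖ - m := by
    rw [← div_mul_cancel₀ (‖f‖ - m) hg'.ne', ← hc]
    gcongr
    linarith
  rw [← hc]
  refine norm_le (by positivity) fun z => ?_
  have hadd : v z * ‖(f + c • g) z‖ ≤ v z * ‖f z‖ + ‖c‖ * (v z * ‖g z‖) :=
    calc v z * ‖f z + c * g z‖ ≤ v z * (‖f z‖ + ‖c * g z‖) :=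
          mul_le_mul_of_nonneg_left (norm_add_le _ _) (v.pos z).le
      _ = v z * ‖f z‖ + ‖c‖ * (v z * ‖g z‖) := by rw [norm_mul]; ring
  refine hadd.trans ?_
  rcases lt_or_ge (v z * ‖g z‖) ε with hz | hz
  · gcongr
    exact le_norm f z
  · calc v z * ‖f z‖ + ‖c‖ * (v z * ‖g z‖) ≤ m + ‖c‖ * ‖g‖ := by
          gcongr
          exacts [hfm z hz, le_norm g z]
      _ ≤ ‖f‖ + ‖c‖ * ε := by nlinarith [mul_nonneg (norm_nonneg c) hε.le]

end PeaksAt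

end LittleWeightedH

theorem exists_norm_add_mul_eq (a b : ℂ) {s : ℝ} (hs : 0 ≤ s) :
    ∃ c : ℂ, ‖c‖ = s ∧ ‖a + c * b‖ = ‖a‖ + s * ‖b‖ := by
  set e : ℝ → ℂ := fun t => Complex.exp (t * Complex.I) with he
  have hnorm (t : ℝ) : ‖e t‖ = 1 := Complex.norm_exp_ofReal_mul_I t
  refine ⟨s * e (a.arg - b.arg), by simp [hnorm, abs_of_nonneg hs], ?_⟩
  have hsplit : e (a.arg - b.arg) * e b.arg = e a.arg := by
    simp only [he, ← Complex.exp_add]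
    push_cast
    ring_nf
  calc ‖a + s * e (a.arg - b.arg) * b‖ = ‖((‖a‖ + s * ‖b‖ : ℝ) : ℂ) * e a.arg‖ := by
        congr 1
        have ha : ‖a‖ * e a.arg = a := Complex.norm_mul_exp_arg_mul_I a
        have hb : ‖b‖ * e b.arg = b := Complex.norm_mul_exp_arg_mul_I b
        push_cast
        linear_combination -ha - s * e (a.arg - b.arg) * hb + s * ‖b‖ * hsplit
    _ = ‖a‖ + s * ‖b‖ := by
        rw [norm_mul, hnorm, mul_one, Complex.norm_of_nonneg (by positivity)]

theorem norm_apply_le_of_norm_add_smul_le {E : Type*} [NormedAddCommGroup E] [NormedSpace ℂ E]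
    {L : E →ₗ[ℂ] ℂ} (hL : ∀ x, ‖L x‖ ≤ ‖x‖) {f g : E} (hf : ‖L f‖ = ‖f‖) {s ε : ℝ} (hs : 0 < s)
    (h : ∀ c : ℂ, ‖c‖ = s → ‖f + c • g‖ ≤ ‖f‖ + s * ε) : ‖L g‖ ≤ ε := by
  obtain ⟨c, hc, hadd⟩ := exists_norm_add_mul_eq (L f) (L g) hs.le
  have hle : ‖f‖ + s * ‖L g‖ ≤ ‖f‖ + s * ε := calc
    ‖f‖ + s * ‖L g‖ = ‖L (f + c • g)‖ := by rw [map_add, map_smul, smul_eq_mul, hadd, hf]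
    _ ≤ ‖f‖ + s * ε := (hL _).trans (h c hc)
  exact le_of_mul_le_mul_left (le_of_add_le_add_left hle) hs

namespace LittleWeightedH

variable {U W : Set ℂ} {v : Weight U} {w : Weight W}

theorem PeaksAt.apply_mul_eq {f : LittleWeightedH v} {p : U} (h : PeaksAt f p)
    {L : LittleWeightedH v →ₗ[ℂ] ℂ} (hL : ∀ g, ‖L g‖ ≤ ‖g‖) (hLf : ‖L f‖ = ‖f‖)
    (g : LittleWeightedH v) : L g * f p = L f * g p := by
  have hzero : L (f p • g - g p • f) = 0 := by
    refine norm_le_zero_iff.mp (le_of_forall_pos_le_add fun ε hε => ?_)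
    obtain ⟨s, hs, hbound⟩ := h.exists_norm_add_smul_le (g := f p • g - g p • f)
      (by rw [sub_apply, smul_apply, smul_apply]; ring) hε
    exact (norm_apply_le_of_norm_add_smul_le hL hLf hs hbound).trans_eq (zero_add ε).symm
  simp only [map_sub, map_smul, smul_eq_mul] at hzero
  linear_combination hzero

/-- The evaluation at `z`, multiplied by the weight. -/
def weightedEval (v : Weight U) (z : U) : LittleWeightedH v →ₗ[ℂ] ℂ where
  toFun f := v z * f z
  map_add' f g := by rw [add_apply, mul_add]
  map_smul' c f := by rw [smul_apply, RingHom.id_apply, smul_eq_mul, mul_left_comm]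

theorem weightedEval_apply (z : U) (f : LittleWeightedH v) : weightedEval v z f = v z * f z := rfl

theorem norm_weightedEval (z : U) (f : LittleWeightedH v) : ‖weightedEval v z f‖ = v z * ‖f z‖ := by
  rw [weightedEval_apply, norm_mul, Complex.norm_of_nonneg (v.pos z).le]

/-- `T` sees evaluation at `q` as `a` times evaluation at `p`, and `a` is of the
modulus that makes the weighted evaluations correspond isometrically. -/
structure TransportsEval (T : LittleWeightedH v → LittleWeightedH w) (q : W) (a : ℂ)
    (p : U) : Prop where
  weight_mul_norm : w q * ‖a‖ = v p
  apply_eq (g : LittleWeightedH v) : T g q = a * g p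

theorem PeaksAt.exists_transportsEval (T : LittleWeightedH v →ₗᵢ[ℂ] LittleWeightedH w)
    {f : LittleWeightedH v} {p : U} (h : PeaksAt f p) (hfp : f p ≠ 0) :
    ∃ q a, TransportsEval T q a p := by
  have hf : f ≠ 0 := fun h0 => hfp (h0 ▸ rfl)
  obtain ⟨q, hq⟩ := exists_norm_eq (f := T f) ((map_ne_zero_iff T T.injective).mpr hf)
  have hw : (w q : ℂ) ≠ 0 := Complex.ofReal_ne_zero.mpr (w.pos q).ne'
  refine ⟨q, T f q / f p, ?_, fun g => ?_⟩
  · rw [norm_div, ← mul_div_assoc, hq, T.norm_map, h.norm_eq,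
      mul_div_cancel_right₀ _ (norm_ne_zero_iff.mpr hfp)]
  · have key := h.apply_mul_eq (L := weightedEval w q ∘ₗ T.toLinearMap)
      (fun g => by simpa [norm_weightedEval] using le_norm (T g) q)
      (by simpa [norm_weightedEval] using hq) g
    simp only [LinearMap.comp_apply, weightedEval_apply, LinearIsometry.coe_toLinearMap] at key
    rw [div_mul_eq_mul_div, eq_div_iff hfp]
    exact mul_left_cancel₀ hw (by linear_combination key)

end LittleWeightedH

theorem one_sub_mul_exp_lt {r s : ℝ} (hs : s < 1) (h : r ≠ s) :
    (1 - r) * Real.exp (r / (1 - s)) < (1 - s) * Real.exp (s / (1 - s)) := by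
  have hs' : 0 < 1 - s := sub_pos.mpr hs
  have hexp : (s - r) / (1 - s) + 1 < Real.exp ((s - r) / (1 - s)) :=
    Real.add_one_lt_exp (div_ne_zero (sub_ne_zero.mpr h.symm) hs'.ne')
  calc (1 - r) * Real.exp (r / (1 - s))
      = (1 - s) * (((s - r) / (1 - s) + 1) * Real.exp (r / (1 - s))) := by field_simp; ring
    _ < (1 - s) * (Real.exp ((s - r) / (1 - s)) * Real.exp (r / (1 - s))) := by gcongr
    _ = (1 - s) * Real.exp (s / (1 - s)) := by rw [← Real.exp_add]; ring_nf

theorem one_sub_norm_mul_exp_re_lt {ζ : ℂ} {s : ℝ} (hs : s < 1) (h : ζ ≠ s) :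
    (1 - ‖ζ‖) * Real.exp (ζ.re / (1 - s)) < (1 - s) * Real.exp (s / (1 - s)) := by
  rcases eq_or_ne ζ.re s with rfl | hre
  · have hlt : ζ.re < ‖ζ‖ := (Complex.re_le_norm ζ).lt_of_ne fun heq =>
      h (by rw [heq]; exact Complex.eq_coe_norm_of_nonneg (Complex.re_eq_norm.mp heq))
    gcongr
  · refine lt_of_le_of_lt ?_ (one_sub_mul_exp_lt hs hre)
    gcongr
    exact Complex.re_le_norm ζ

theorem cocompact_unitDisc : cocompact unitDisc = comap (fun z : unitDisc => ‖(z : ℂ)‖) (𝓝 1) := by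
  refine le_antisymm (tendsto_iff_comap.mp <| tendsto_order.mpr ⟨fun r hr => ?_, fun r hr =>
    .of_forall fun z => (norm_lt_one_of_disc z).trans hr⟩) fun s hs => ?_
  · refine mem_cocompact.mpr ⟨Subtype.val ⁻¹' Metric.closedBall (0 : ℂ) r, ?_, fun z hz => ?_⟩
    · refine Subtype.isCompact_iff.mpr ?_
      rw [Subtype.image_preimage_coe, Set.inter_eq_right.mpr (Metric.closedBall_subset_ball hr)]
      exact isCompact_closedBall 0 r
    · simpa using hz
  · obtain ⟨K, hK, hKs⟩ := mem_cocompact.mp hs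
    obtain rfl | hne := K.eq_empty_or_nonempty
    · exact mem_of_superset univ_mem (by simpa using hKs)
    · obtain ⟨x, -, hmax⟩ := hK.exists_isMaxOn hne
        (f := fun z : unitDisc => ‖(z : ℂ)‖) (by fun_prop)
      refine ⟨Set.Ioi ‖(x : ℂ)‖, Ioi_mem_nhds (norm_lt_one_of_disc x), fun z hz => hKs ?_⟩
      intro hzK
      have hle : ‖(z : ℂ)‖ ≤ ‖(x : ℂ)‖ := hmax hzK
      exact hle.not_gt hz

theorem tendsto_norm_cocompact_unitDisc :
    Tendsto (fun z : unitDisc => ‖(z : ℂ)‖) (cocompact unitDisc) (𝓝 1) :=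
  tendsto_iff_comap.mpr cocompact_unitDisc.le

theorem tendsto_discWeight_cocompact : Tendsto discWeight (cocompact unitDisc) (𝓝 0) := by
  simpa only [sub_self] using! tendsto_norm_cocompact_unitDisc.const_sub 1

theorem tendsto_discWeightSq_cocompact : Tendsto discWeightSq (cocompact unitDisc) (𝓝 0) := by
  simpa only [one_pow, sub_self] using! (tendsto_norm_cocompact_unitDisc.pow 2).const_sub 1

theorem discWeight_discSq (z : unitDisc) : discWeight (discSq z) = discWeightSq z :=
  congrArg (1 - ·) (norm_pow (z : ℂ) 2)

theorem tendsto_discSq_cocompact : Tendsto discSq (cocompact unitDisc) (cocompact unitDisc) := by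
  rw [cocompact_unitDisc, tendsto_comap_iff, ← cocompact_unitDisc]
  simpa [Function.comp_def, discSq] using tendsto_norm_cocompact_unitDisc.pow 2

theorem exists_peaksAt_discWeight (p : unitDisc) :
    ∃ f : LittleWeightedH discWeight, LittleWeightedH.PeaksAt f p ∧ f p ≠ 0 := by
  set s : ℝ := ‖(p : ℂ)‖
  set u : ℂ := Complex.exp ((p : ℂ).arg * Complex.I) with hu
  have hup : s * u = p := Complex.norm_mul_exp_arg_mul_I _
  have hnorm (z : ℂ) : ‖conj u * z‖ = ‖z‖ := by
    rw [norm_mul, RCLike.norm_conj, hu, Complex.norm_exp_ofReal_mul_I, one_mul]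
  have huu : u * conj u = 1 := by
    rw [Complex.mul_conj', hu, Complex.norm_exp_ofReal_mul_I, Complex.ofReal_one, one_pow]
  -- On the ray through `p`, `log (1 - r) + r / (1 - s)` is stationary exactly at `r = s`.
  let f : LittleWeightedH discWeight :=
    LittleWeightedH.ofEntire Metric.isBounded_ball tendsto_discWeight_cocompact
      (fun z => Complex.exp (conj u * z / (1 - s : ℝ))) (by fun_prop)
  have hf (z : unitDisc) : discWeight z * ‖f z‖ =
      (1 - ‖conj u * z‖) * Real.exp ((conj u * z).re / (1 - s)) := by
    rw [hnorm, ← Complex.div_ofReal_re, ← Complex.norm_exp]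
    rfl
  have hp : conj u * p = s := by rw [← hup, mul_left_comm, mul_comm (conj u), huu, mul_one]
  refine ⟨f, fun z hz => ?_, Complex.exp_ne_zero _⟩
  have hne : conj u * z ≠ s := fun h => hz (Subtype.ext (by
    rw [← hup, ← h]; linear_combination -(z : ℂ) * huu))
  rw [hf, hf, hp, Complex.ofReal_re]
  simpa [s] using one_sub_norm_mul_exp_re_lt (norm_lt_one_of_disc p) hne

theorem discSq_surjective : Function.Surjective discSq := fun z => by
  obtain ⟨u, hu⟩ := IsAlgClosed.exists_pow_nat_eq (z : ℂ) two_pos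
  have hu1 : ‖u‖ ^ 2 < 1 := by rw [← norm_pow, hu]; exact norm_lt_one_of_disc z
  exact ⟨⟨u, mem_ball_zero_iff.mpr ((sq_lt_one_iff₀ (norm_nonneg u)).mp hu1)⟩, Subtype.ext hu⟩

theorem isHolomorphic_discSq : IsHolomorphic fun z => (discSq z : ℂ) :=
  .congr_ext (differentiable_pow 2).differentiableOn fun _ => rfl

/-- The isometry `S` of the theorem: composition with the squaring map. -/
def compSq : LittleWeightedH discWeight →ₗᵢ[ℂ] LittleWeightedH discWeightSq :=
  LittleWeightedH.pullback discSq isHolomorphic_discSq tendsto_discSq_cocompact discSq_surjective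
    discWeight_discSq

theorem compSq_apply (f : LittleWeightedH discWeight) (z : unitDisc) :
    compSq f z = f (discSq z) := rfl

theorem compSq_not_surjective : ¬ Function.Surjective compSq := fun h => by
  obtain ⟨f, hf⟩ := h (LittleWeightedH.ofEntire Metric.isBounded_ball
    tendsto_discWeightSq_cocompact id differentiable_id)
  let z : unitDisc := ⟨1 / 2, by norm_num⟩
  let z' : unitDisc := ⟨-(1 / 2), by norm_num⟩
  have hsq : discSq z = discSq z' := Subtype.ext (neg_sq (1 / 2 : ℂ)).symm
  have heq : (1 / 2 : ℂ) = -(1 / 2) := calc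
    (1 / 2 : ℂ) = compSq f z := by rw [hf]; rfl
    _ = compSq f z' := by rw [compSq_apply, hsq, ← compSq_apply]
    _ = -(1 / 2) := by rw [hf]; rfl
  norm_num at heq

/-- The constant function `1` as a member of the little weighted space of the disc. -/
def oneFun : LittleWeightedH discWeight :=
  LittleWeightedH.ofEntire Metric.isBounded_ball tendsto_discWeight_cocompact 1
    (differentiable_const 1)

/-- The identity function as a member of the little weighted space of the disc. -/
def idFun : LittleWeightedH discWeight :=
  LittleWeightedH.ofEntire Metric.isBounded_ball tendsto_discWeight_cocompact id differentiable_id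

theorem oneFun_apply (z : unitDisc) : oneFun z = 1 := rfl

theorem idFun_apply (z : unitDisc) : idFun z = z := rfl

namespace LittleWeightedH

variable {W : Set ℂ} {w : Weight W}

namespace TransportsEval

variable {T : LittleWeightedH discWeight → LittleWeightedH w} {q : W} {a : ℂ} {p : unitDisc}

theorem eq_apply_oneFun (h : TransportsEval T q a p) : a = T oneFun q := by
  rw [h.apply_eq, oneFun_apply, mul_one]

theorem apply_oneFun_ne_zero (h : TransportsEval T q a p) : T oneFun q ≠ 0 := by
  rintro h0
  have hw := h.weight_mul_norm
  rw [h.eq_apply_oneFun, h0, norm_zero, mul_zero] at hw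
  exact (discWeight.pos p).ne hw

theorem coe_eq_div (h : TransportsEval T q a p) : (p : ℂ) = T idFun q / T oneFun q := by
  rw [eq_div_iff h.apply_oneFun_ne_zero, h.apply_eq idFun, ← h.eq_apply_oneFun, idFun_apply,
    mul_comm]

theorem exists_of_mem_closure {S : Set W} (hS : ∀ q ∈ S, ∃ a p, TransportsEval T q a p)
    (hq : q ∈ closure S) (h1 : T oneFun q ≠ 0) : ∃ a p, TransportsEval T q a p := by
  have hcont (g : LittleWeightedH discWeight) : ContinuousAt (fun q => T g q) q :=
    (isHolomorphic (T g)).continuous.continuousAt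
  have hdiv : ContinuousAt (fun q => T idFun q / T oneFun q) q :=
    (hcont idFun).div (hcont oneFun) h1
  have hfreq : ∃ᶠ q in 𝓝 q, ∃ a p, TransportsEval T q a p :=
    (mem_closure_iff_frequently.mp hq).mono hS
  have hweight : w q * ‖T oneFun q‖ = 1 - ‖T idFun q / T oneFun q‖ := by
    refine tendsto_nhds_unique_of_frequently_eq (f := fun q => w q * ‖T oneFun q‖)
      (w.continuous_toFun.continuousAt.mul (hcont oneFun).norm).tendsto
      (hdiv.norm.const_sub 1) (hfreq.mono ?_)
    rintro q ⟨a, p, h⟩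
    rw [← h.coe_eq_div, ← h.eq_apply_oneFun]
    exact h.weight_mul_norm
  have hmem : T idFun q / T oneFun q ∈ unitDisc := by
    rw [mem_ball_zero_iff, ← sub_pos, ← hweight]
    exact mul_pos (w.pos q) (norm_pos_iff.mpr h1)
  refine ⟨T oneFun q, ⟨_, hmem⟩, hweight, fun g => ?_⟩
  rw [← extendZero_apply g.1.1]
  refine tendsto_nhds_unique_of_frequently_eq (hcont g) ((hcont oneFun).tendsto.mul
    (((isHolomorphic g).differentiableAt Metric.isOpen_ball ⟨_, hmem⟩).continuousAt.tendsto.comp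
      hdiv)) (hfreq.mono ?_)
  rintro q ⟨a, p, h⟩
  rw [h.apply_eq, h.eq_apply_oneFun, Function.comp_apply, ← h.coe_eq_div, extendZero_apply]

end TransportsEval

theorem not_isNowhereDense_setOf_transportsEval (hW : IsOpen W)
    (T : LittleWeightedH discWeight →ₗᵢ[ℂ] LittleWeightedH w) :
    ¬ IsNowhereDense {q : W | ∃ a, ∃ p : unitDisc, (p : ℂ) ≠ 0 ∧ TransportsEval T q a p} := by
  intro hE
  set E := {q : W | ∃ a, ∃ p : unitDisc, (p : ℂ) ≠ 0 ∧ TransportsEval T q a p}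
  set φ : ℂ → ℂ := fun z => extendZero (T idFun).1.1 z / extendZero (T oneFun).1.1 z
  have hφ (q : W) : φ q = T idFun q / T oneFun q := by simp only [φ, extendZero_apply]
  have han : AnalyticOnNhd ℂ φ ((↑) '' E) := by
    rintro _ ⟨q, ⟨a, p, -, h⟩, rfl⟩
    have han (f : LittleWeightedH w) : AnalyticAt ℂ (extendZero f.1.1) q :=
      DifferentiableOn.analyticAt (isHolomorphic f) (hW.mem_nhds q.2)
    exact (han _).div (han _) (by rw [extendZero_apply]; exact h.apply_oneFun_ne_zero)
  refine not_isMeagre_of_isOpen (Metric.isOpen_ball.sdiff isClosed_singleton)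
    (s := unitDisc \ {0}) ⟨1 / 2, by norm_num⟩
    ((isMeagre_image_of_analyticOnNhd han hE.image_val).mono ?_)
  rintro p ⟨hp, hp0⟩
  obtain ⟨f, hf, hfp⟩ := exists_peaksAt_discWeight ⟨p, hp⟩
  obtain ⟨q, a, h⟩ := hf.exists_transportsEval T hfp
  exact ⟨q, ⟨q, ⟨a, ⟨p, hp⟩, hp0, h⟩, rfl⟩, (hφ q).trans h.coe_eq_div.symm⟩

theorem exists_isOpen_transportsEval (hW : IsOpen W)
    (T : LittleWeightedH discWeight →ₗᵢ[ℂ] LittleWeightedH w) :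
    ∃ V : Set W, IsOpen V ∧ V.Nonempty ∧
      ∀ q ∈ V, ∃ a, ∃ p : unitDisc, (p : ℂ) ≠ 0 ∧ TransportsEval T q a p := by
  set E := {q : W | ∃ a, ∃ p : unitDisc, (p : ℂ) ≠ 0 ∧ TransportsEval T q a p}
  have hcont (f : LittleWeightedH w) : Continuous f := (isHolomorphic f).continuous
  obtain ⟨q₀, hq₀⟩ : (interior (closure E)).Nonempty :=
    Set.nonempty_iff_ne_empty.mpr (not_isNowhereDense_setOf_transportsEval hW T)
  obtain ⟨q, hq, hqE⟩ := mem_closure_iff.mp (interior_subset hq₀) _ isOpen_interior hq₀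
  refine ⟨interior (closure E) ∩ {q | T oneFun q ≠ 0} ∩ {q | T idFun q ≠ 0},
    (isOpen_interior.inter (isOpen_ne_fun (hcont _) continuous_const)).inter
      (isOpen_ne_fun (hcont _) continuous_const), ⟨q, ⟨hq, ?_⟩, ?_⟩, ?_⟩
  · obtain ⟨a, p, -, h⟩ := hqE
    exact h.apply_oneFun_ne_zero
  · obtain ⟨a, p, hp, h⟩ := hqE
    exact fun h0 => hp (by rw [h.coe_eq_div, h0, zero_div])
  · rintro q ⟨⟨hq, hq1⟩, hq0⟩
    obtain ⟨a, p, h⟩ := TransportsEval.exists_of_mem_closure (S := E)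
      (fun q ⟨a, p, _, h⟩ => ⟨a, p, h⟩) (interior_subset hq) hq1
    exact ⟨a, p, by rw [h.coe_eq_div]; exact div_ne_zero hq0 hq1, h⟩

end LittleWeightedH

theorem holDeriv_eq_of_hasDerivAt {U : Set ℂ} {f : U → ℂ} {F : ℂ → ℂ} {F' : ℂ} {z : U}
    (hU : IsOpen U) (h : ∀ z : U, f z = F z) (hF : HasDerivAt F F' z) : holDeriv f z = F' := by
  refine (hF.congr_of_eventuallyEq ?_).deriv
  filter_upwards [hU.mem_nhds z.2] with x hx
  exact (extendZero_apply f ⟨x, hx⟩).trans (h ⟨x, hx⟩)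

namespace DiscAut

/-- The automorphism `φ` of the disc followed by the automorphism `ψ`. -/
def trans (φ ψ : DiscAut) : DiscAut where
  toEquiv := φ.toEquiv.trans ψ.toEquiv
  holomorphic_toFun := ψ.holomorphic_toFun.comp φ.holomorphic_toFun
  holomorphic_invFun := φ.holomorphic_invFun.comp ψ.holomorphic_invFun

theorem trans_apply (φ ψ : DiscAut) (z : unitDisc) : φ.trans ψ z = ψ (φ z) := rfl

theorem hasDerivAt (ψ : DiscAut) (z : unitDisc) :
    HasDerivAt (extendZero fun u => (ψ u : ℂ)) (ψ.derivative z) z :=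
  (ψ.holomorphic_toFun.differentiableAt Metric.isOpen_ball z).hasDerivAt

theorem derivative_trans (φ ψ : DiscAut) (z : unitDisc) :
    (φ.trans ψ).derivative z = ψ.derivative (φ z) * φ.derivative z := by
  have hψ : HasDerivAt (extendZero fun u => (ψ u : ℂ)) (ψ.derivative (φ z))
      (extendZero (fun u => (φ u : ℂ)) z) := by
    rw [extendZero_apply]
    exact ψ.hasDerivAt (φ z)
  refine holDeriv_eq_of_hasDerivAt Metric.isOpen_ball (fun z => ?_) (hψ.comp _ (φ.hasDerivAt z))
  rw [Function.comp_apply, extendZero_apply, extendZero_apply, trans_apply]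

/-- Invariance under `ψ` of the Bergman kernel `1 / (1 - z conj(w))²` of the disc, with the
denominators cleared. -/
def PreservesBergmanKernel (ψ : DiscAut) : Prop :=
  ∀ z w : unitDisc, ψ.derivative z * conj (ψ.derivative w) * (1 - z * conj (w : ℂ)) ^ 2 =
    (1 - ψ z * conj (ψ w : ℂ)) ^ 2

theorem PreservesBergmanKernel.trans {φ ψ : DiscAut} (hφ : φ.PreservesBergmanKernel)
    (hψ : ψ.PreservesBergmanKernel) : (φ.trans ψ).PreservesBergmanKernel := fun z w => by
  rw [derivative_trans, derivative_trans, trans_apply, trans_apply, ← hψ, ← hφ, map_mul]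
  ring

/-- The rotation `z ↦ u z` of the disc. -/
def rotation (u : Circle) : DiscAut where
  toFun z := ⟨u * z, by simpa [u.norm_coe] using norm_lt_one_of_disc z⟩
  invFun z := ⟨u⁻¹ * z, by simpa [u.norm_coe] using norm_lt_one_of_disc z⟩
  left_inv z := Subtype.ext (inv_mul_cancel_left₀ u.coe_ne_zero (z : ℂ))
  right_inv z := Subtype.ext (mul_inv_cancel_left₀ u.coe_ne_zero (z : ℂ))
  holomorphic_toFun := .congr_ext (differentiable_id.const_mul _).differentiableOn fun _ => rfl
  holomorphic_invFun := .congr_ext (differentiable_id.const_mul _).differentiableOn fun _ => rfl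

theorem coe_rotation_apply (u : Circle) (z : unitDisc) : (rotation u z : ℂ) = u * z := rfl

theorem preservesBergmanKernel_rotation (u : Circle) :
    (rotation u).PreservesBergmanKernel := fun z w => by
  have hderiv (z : unitDisc) : (rotation u).derivative z = u :=
    holDeriv_eq_of_hasDerivAt Metric.isOpen_ball (fun _ => rfl) (hasDerivAt_const_mul (u : ℂ))
  have hu : (u : ℂ) * conj (u : ℂ) = 1 := by rw [Complex.mul_conj', u.norm_coe]; norm_num
  rw [hderiv, hderiv, coe_rotation_apply, coe_rotation_apply, map_mul, hu, one_mul]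
  congr 2
  linear_combination -(z : ℂ) * conj (w : ℂ) * hu

end DiscAut

theorem one_sub_conj_mul_ne_zero (p z : unitDisc) : 1 - conj (p : ℂ) * z ≠ 0 := by
  refine sub_ne_zero.mpr fun h => ?_
  have hlt : ‖conj (p : ℂ) * z‖ < 1 := by
    rw [norm_mul, RCLike.norm_conj]
    exact mul_lt_one_of_nonneg_of_lt_one_left (norm_nonneg _) (norm_lt_one_of_disc p)
      (norm_lt_one_of_disc z).le
  rw [← h, norm_one] at hlt
  exact hlt.false

/-- The Blaschke factor with zero `p`. -/
def blaschkeFactor (p z : ℂ) : ℂ := (z - p) / (1 - conj p * z)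

theorem one_sub_blaschkeFactor_mul_conj (p z w : unitDisc) :
    1 - blaschkeFactor p z * conj (blaschkeFactor p w) =
      (1 - p * conj (p : ℂ)) * (1 - z * conj (w : ℂ)) /
        ((1 - conj (p : ℂ) * z) * conj (1 - conj (p : ℂ) * w)) := by
  have hz := one_sub_conj_mul_ne_zero p z
  have hw := (map_ne_zero conj).mpr (one_sub_conj_mul_ne_zero p w)
  have hBz : blaschkeFactor p z * (1 - conj (p : ℂ) * z) = z - p := div_mul_cancel₀ _ hz
  have hBw : conj (blaschkeFactor p w) * conj (1 - conj (p : ℂ) * w) = conj (w - p : ℂ) := by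
    rw [← map_mul, blaschkeFactor, div_mul_cancel₀ _ (one_sub_conj_mul_ne_zero p w)]
  rw [eq_div_iff (mul_ne_zero hz hw), sub_mul, one_mul, mul_mul_mul_comm, hBz, hBw]
  simp only [map_sub, map_mul, map_one, Complex.conj_conj]
  ring

theorem blaschkeFactor_mem (p z : unitDisc) : blaschkeFactor p z ∈ unitDisc := by
  have hne := norm_pos_iff.mpr (one_sub_conj_mul_ne_zero p z)
  have key := one_sub_blaschkeFactor_mul_conj p z z
  simp only [Complex.mul_conj'] at key
  have hpos : 0 < 1 - ‖blaschkeFactor p z‖ ^ 2 := calc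
    0 < (1 - ‖(p : ℂ)‖ ^ 2) * (1 - ‖(z : ℂ)‖ ^ 2) / ‖1 - conj (p : ℂ) * z‖ ^ 2 :=
      div_pos (mul_pos (discWeightSq.pos p) (discWeightSq.pos z)) (pow_pos hne 2)
    _ = _ := by exact_mod_cast key.symm
  exact mem_ball_zero_iff.mpr ((sq_lt_one_iff₀ (norm_nonneg _)).mp (sub_pos.mp hpos))

theorem blaschkeFactor_neg_blaschkeFactor (p z : unitDisc) :
    blaschkeFactor (-p) (blaschkeFactor p z) = z := by
  have hz := one_sub_conj_mul_ne_zero p z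
  have hp : 1 - conj (p : ℂ) * p ≠ 0 := one_sub_conj_mul_ne_zero p p
  have hden : 1 - conj (-p : ℂ) * blaschkeFactor p z =
      (1 - conj (p : ℂ) * p) / (1 - conj (p : ℂ) * z) := by
    rw [blaschkeFactor, map_neg, eq_div_iff hz, sub_mul, mul_assoc, div_mul_cancel₀ _ hz]
    ring
  rw [blaschkeFactor, hden, div_div_eq_mul_div, div_eq_iff hp, sub_mul, blaschkeFactor,
    div_mul_cancel₀ _ hz]
  ring

theorem hasDerivAt_blaschkeFactor (p z : unitDisc) :
    HasDerivAt (blaschkeFactor p) ((1 - p * conj (p : ℂ)) / (1 - conj (p : ℂ) * z) ^ 2) z := by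
  have hden : HasDerivAt (fun x => 1 - conj (p : ℂ) * x) (-conj (p : ℂ)) z :=
    (hasDerivAt_const_mul _).const_sub 1
  refine (((hasDerivAt_id' (z : ℂ)).sub_const (p : ℂ)).fun_div hden
    (one_sub_conj_mul_ne_zero p z)).congr_deriv ?_
  ring

theorem differentiableOn_blaschkeFactor (p : unitDisc) :
    DifferentiableOn ℂ (blaschkeFactor p) unitDisc := fun z hz =>
  (hasDerivAt_blaschkeFactor p ⟨z, hz⟩).differentiableAt.differentiableWithinAt

namespace DiscAut

/-- The automorphism of the disc given by the Blaschke factor with zero `p`. -/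
def blaschke (p : unitDisc) : DiscAut where
  toFun z := ⟨_, blaschkeFactor_mem p z⟩
  invFun z := ⟨_, blaschkeFactor_mem (-p) z⟩
  left_inv z := Subtype.ext (blaschkeFactor_neg_blaschkeFactor p z)
  right_inv z := Subtype.ext <| by simpa using blaschkeFactor_neg_blaschkeFactor (-p) z
  holomorphic_toFun := .congr_ext (differentiableOn_blaschkeFactor p) fun _ => rfl
  holomorphic_invFun := .congr_ext (differentiableOn_blaschkeFactor (-p)) fun _ => rfl

theorem coe_blaschke_apply (p z : unitDisc) : (blaschke p z : ℂ) = blaschkeFactor p z := rfl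

theorem blaschke_neg_apply (p z : unitDisc) : blaschke (-p) (blaschke p z) = z :=
  (blaschke p).left_inv z

theorem preservesBergmanKernel_blaschke (p : unitDisc) :
    (blaschke p).PreservesBergmanKernel := fun z w => by
  have hderiv (z : unitDisc) : (blaschke p).derivative z =
      (1 - p * conj (p : ℂ)) / (1 - conj (p : ℂ) * z) ^ 2 :=
    holDeriv_eq_of_hasDerivAt Metric.isOpen_ball (fun _ => rfl) (hasDerivAt_blaschkeFactor p z)
  rw [hderiv, hderiv, coe_blaschke_apply, coe_blaschke_apply, one_sub_blaschkeFactor_mul_conj]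
  have hz := one_sub_conj_mul_ne_zero p z
  have hw := (map_ne_zero conj).mpr (one_sub_conj_mul_ne_zero p w)
  have hp : conj (1 - p * conj (p : ℂ)) = 1 - p * conj (p : ℂ) := by
    rw [map_sub, map_one, map_mul, Complex.conj_conj, mul_comm]
  rw [map_div₀, map_pow, hp]
  field_simp

end DiscAut

theorem exists_circle_mul_eq {ι : Type*} {F G : ι → ℂ}
    (h : ∀ i j, F i * conj (F j) = G i * conj (G j)) : ∃ u : Circle, ∀ i, F i = u * G i := by
  have hnorm (i : ι) : ‖F i‖ = ‖G i‖ := by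
    have hsq := h i i
    rw [Complex.mul_conj', Complex.mul_conj'] at hsq
    exact (pow_left_inj₀ (norm_nonneg _) (norm_nonneg _) two_ne_zero).mp (by exact_mod_cast hsq)
  by_cases! hG : ∃ j, G j ≠ 0
  · obtain ⟨j, hj⟩ := hG
    have hF : F j ≠ 0 := norm_ne_zero_iff.mp (hnorm j ▸ norm_ne_zero_iff.mpr hj)
    refine ⟨⟨F j / G j, mem_sphere_zero_iff_norm.mpr ?_⟩, fun i => ?_⟩
    · rw [norm_div, hnorm, div_self (norm_ne_zero_iff.mpr hj)]
    · refine mul_right_cancel₀ ((map_ne_zero conj).mpr hF) ?_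
      rw [h i j]
      field_simp
      linear_combination -G i * h j j
  · exact ⟨1, fun i => by rw [hG, mul_zero, ← norm_eq_zero, hnorm, hG, norm_zero]⟩

section KernelRigidity

variable {ι : Type*} {g : ι → ℂ} {φ ψ : ι → unitDisc}

theorem blaschkeFactor_mul_conj_eq
    (h : ∀ i j, g i * conj (g j) * (1 - φ i * conj (φ j : ℂ)) = 1 - ψ i * conj (ψ j : ℂ))
    (k i j : ι) :
    blaschkeFactor (ψ k) (ψ i) * conj (blaschkeFactor (ψ k) (ψ j)) =
      blaschkeFactor (φ k) (φ i) * conj (blaschkeFactor (φ k) (φ j)) := by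
  have hk (i : ι) : 1 - conj (ψ k : ℂ) * ψ i = g i * conj (g k) * (1 - conj (φ k : ℂ) * φ i) := by
    linear_combination -h i k
  have hg (i : ι) : g i ≠ 0 := fun h0 => one_sub_conj_mul_ne_zero (ψ i) (ψ i) <| by
    linear_combination -h i i + conj (g i) * (1 - φ i * conj (φ i : ℂ)) * h0
  have hgk := (map_ne_zero conj).mpr (hg k)
  have hgj := (map_ne_zero conj).mpr (hg j)
  have hi := one_sub_conj_mul_ne_zero (φ k) (φ i)
  have hj := (map_ne_zero conj).mpr (one_sub_conj_mul_ne_zero (φ k) (φ j))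
  rw [← sub_right_inj (a := 1), one_sub_blaschkeFactor_mul_conj,
    one_sub_blaschkeFactor_mul_conj, hk, hk, ← h, ← h, map_mul, map_mul, Complex.conj_conj]
  field_simp [hg]

theorem exists_discAut_of_kernel_eq [Nonempty ι]
    (h : ∀ i j, g i * conj (g j) * (1 - φ i * conj (φ j : ℂ)) = 1 - ψ i * conj (ψ j : ℂ)) :
    ∃ (Ψ : DiscAut) (c : Circle), ∀ i, ψ i = Ψ (φ i) ∧ g i ^ 2 = c * Ψ.derivative (φ i) := by
  obtain ⟨k⟩ := ‹Nonempty ι›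
  obtain ⟨u, hu⟩ := exists_circle_mul_eq (blaschkeFactor_mul_conj_eq h k)
  let Ψ := ((DiscAut.blaschke (φ k)).trans (.rotation u)).trans (.blaschke (-ψ k))
  have hΨ : Ψ.PreservesBergmanKernel := ((DiscAut.preservesBergmanKernel_blaschke _).trans
    (DiscAut.preservesBergmanKernel_rotation u)).trans (DiscAut.preservesBergmanKernel_blaschke _)
  have hψ (i : ι) : ψ i = Ψ (φ i) := by
    have hrot : DiscAut.rotation u (DiscAut.blaschke (φ k) (φ i)) = DiscAut.blaschke (ψ k) (ψ i) :=
      Subtype.ext (hu i).symm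
    rw [DiscAut.trans_apply, DiscAut.trans_apply, hrot, DiscAut.blaschke_neg_apply]
  obtain ⟨c, hc⟩ := exists_circle_mul_eq (F := fun i => g i ^ 2)
    (G := fun i => Ψ.derivative (φ i)) fun i j => by
      have hij : 1 - φ i * conj (φ j : ℂ) ≠ 0 := by
        rw [mul_comm]
        exact one_sub_conj_mul_ne_zero (φ j) (φ i)
      refine mul_right_cancel₀ (pow_ne_zero 2 hij) ?_
      rw [hΨ, ← hψ, ← hψ, ← h, map_pow, ← mul_pow, ← mul_pow]
  exact ⟨Ψ, c, fun i => ⟨hψ i, hc i⟩⟩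

end KernelRigidity

theorem exists_pow_eq_of_analyticAt {h : ℂ → ℂ} {q : ℂ} (hh : AnalyticAt ℂ h q) (h0 : h q ≠ 0)
    {n : ℕ} (hn : n ≠ 0) : ∃ g : ℂ → ℂ, AnalyticAt ℂ g q ∧ ∀ᶠ z in 𝓝 q, g z ^ n = h z := by
  obtain ⟨s, hs⟩ := IsAlgClosed.exists_pow_nat_eq (h q) (Nat.pos_of_ne_zero hn)
  have hn' : (n : ℂ) ≠ 0 := Nat.cast_ne_zero.mpr hn
  have hlog : AnalyticAt ℂ (fun z => Complex.log (h z / h q)) q :=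
    (hh.div analyticAt_const h0).clog (by simp [h0])
  refine ⟨fun z => s * Complex.exp (Complex.log (h z / h q) / n),
    analyticAt_const.mul (hlog.div analyticAt_const hn').cexp, ?_⟩
  filter_upwards [hh.continuousAt.eventually_ne h0] with z hz
  rw [mul_pow, hs, ← Complex.exp_nat_mul, mul_div_cancel₀ _ hn',
    Complex.exp_log (div_ne_zero hz h0), mul_div_cancel₀ _ h0]

theorem mul_conj_mul_one_sub_eq {Ω : Set ℂ} (hΩ : IsOpen Ω) (hΩ' : IsPreconnected Ω) {g ψ : ℂ → ℂ}
    (hg : DifferentiableOn ℂ g Ω) (hψ : DifferentiableOn ℂ ψ Ω)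
    (h : ∀ z ∈ Ω, (1 - ‖z‖ ^ 2) * ‖g z‖ ^ 2 = 1 - ‖ψ z‖ ^ 2) {z w : ℂ} (hz : z ∈ Ω) (hw : w ∈ Ω) :
    g z * conj (g w) * (1 - z * conj w) = 1 - ψ z * conj (ψ w) := by
  have hF : DifferentiableOn ℂ (fun z => !₂[g z, ψ z]) Ω := by
    refine (differentiableOn_euclidean).mpr fun i => ?_
    fin_cases i
    exacts [hg, hψ]
  have hG : DifferentiableOn ℂ (fun z => !₂[1, z * g z]) Ω := by
    refine (differentiableOn_euclidean).mpr fun i => ?_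
    fin_cases i
    exacts [differentiableOn_const 1, differentiableOn_id.mul hg]
  have hnorm (z : ℂ) (hz : z ∈ Ω) : ‖!₂[g z, ψ z]‖ = ‖!₂[1, z * g z]‖ := by
    rw [EuclideanSpace.norm_eq, EuclideanSpace.norm_eq]
    congr 1
    rw [Fin.sum_univ_two, Fin.sum_univ_two]
    change ‖g z‖ ^ 2 + ‖ψ z‖ ^ 2 = ‖(1 : ℂ)‖ ^ 2 + ‖z * g z‖ ^ 2
    rw [norm_one, norm_mul]
    linear_combination h z hz
  have hinner : g z * conj (g w) + ψ z * conj (ψ w) = 1 + z * g z * conj (w * g w) := by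
    simpa [PiLp.inner_apply, Fin.sum_univ_two] using
      inner_eq_inner_of_norm_eq_norm hΩ hΩ' hF hG hnorm hz hw
  rw [map_mul] at hinner
  linear_combination hinner

namespace LittleWeightedH

theorem exists_transportsEval_sq {W : Set ℂ} {w : Weight W} (hW : IsOpen W)
    (T : LittleWeightedH discWeight →ₗᵢ[ℂ] LittleWeightedH w) :
    ∃ (g ψ : ℂ → ℂ) (q : W), AnalyticAt ℂ g q ∧ AnalyticAt ℂ ψ q ∧
      ∀ᶠ x in 𝓝 (q : ℂ), ∃ (z : W) (b : unitDisc), (z : ℂ) = x ∧ (b : ℂ) = ψ x ∧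
        TransportsEval T z (g x ^ 2) (discSq b) := by
  obtain ⟨V, hV, ⟨q, hq⟩, hT⟩ := exists_isOpen_transportsEval hW T
  obtain ⟨a, p, hp, hpq⟩ := hT q hq
  have han (f : LittleWeightedH w) : AnalyticAt ℂ (extendZero f.1.1) q :=
    DifferentiableOn.analyticAt (isHolomorphic f) (hW.mem_nhds q.2)
  have h1 : extendZero (T oneFun).1.1 q ≠ 0 := by
    rw [extendZero_apply]
    exact hpq.apply_oneFun_ne_zero
  obtain ⟨g, hg, hgT⟩ := exists_pow_eq_of_analyticAt (han (T oneFun)) h1 two_ne_zero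
  obtain ⟨ψ, hψ, hψT⟩ := exists_pow_eq_of_analyticAt ((han (T idFun)).div (han (T oneFun)) h1)
    (by rwa [Pi.div_apply, extendZero_apply, extendZero_apply, ← hpq.coe_eq_div]) two_ne_zero
  refine ⟨g, ψ, q, hg, hψ, ?_⟩
  filter_upwards [hgT, hψT, (hW.isOpenMap_subtype_val V hV).mem_nhds ⟨q, hq, rfl⟩]
  rintro _ hgx hψx ⟨z, hz, rfl⟩
  obtain ⟨a, p, -, h⟩ := hT z hz
  rw [extendZero_apply, ← h.eq_apply_oneFun] at hgx
  rw [Pi.div_apply, extendZero_apply, extendZero_apply, ← h.coe_eq_div] at hψx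
  have hmem : ψ z ∈ unitDisc := by
    rw [mem_ball_zero_iff, ← sq_lt_one_iff₀ (norm_nonneg _), ← norm_pow, hψx]
    exact norm_lt_one_of_disc p
  refine ⟨z, ⟨ψ z, hmem⟩, rfl, rfl, ?_⟩
  rw [hgx, show discSq ⟨ψ z, hmem⟩ = p from Subtype.ext hψx]
  exact h

theorem exists_eventually_transportsEval
    (T : LittleWeightedH discWeight →ₗᵢ[ℂ] LittleWeightedH discWeightSq) :
    ∃ (Ψ : DiscAut) (c : Circle) (q : unitDisc),
      ∀ᶠ z in 𝓝 q, TransportsEval T z (c * Ψ.derivative z) (discSq (Ψ z)) := by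
  obtain ⟨g, ψ, q, hg, hψ, hT⟩ := exists_transportsEval_sq Metric.isOpen_ball T
  obtain ⟨R, hR, hball⟩ := Metric.eventually_nhds_iff_ball.mp
    ((hg.eventually_analyticAt.and hψ.eventually_analyticAt).and hT)
  choose! han z b hz hb hT using hball
  have hnorm (x : ℂ) (hx : x ∈ Metric.ball (q : ℂ) R) :
      (1 - ‖x‖ ^ 2) * ‖g x‖ ^ 2 = 1 - ‖ψ x‖ ^ 2 := by
    have hweight := (hT x hx).weight_mul_norm
    rw [discWeight_discSq, norm_pow] at hweight
    rw [← hb x hx]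
    nth_rw 1 [← hz x hx]
    exact hweight
  have : Nonempty (Metric.ball (q : ℂ) R) := ⟨q, Metric.mem_ball_self hR⟩
  obtain ⟨Ψ, c, hΨ⟩ := exists_discAut_of_kernel_eq (g := fun x : Metric.ball (q : ℂ) R => g x)
    (φ := fun x => z x) (ψ := fun x => b x) fun x y => by
      rw [hz _ x.2, hz _ y.2, hb _ x.2, hb _ y.2]
      exact mul_conj_mul_one_sub_eq Metric.isOpen_ball (convex_ball _ _).isPreconnected
        (fun x hx => (han x hx).1.differentiableAt.differentiableWithinAt)
        (fun x hx => (han x hx).2.differentiableAt.differentiableWithinAt) hnorm x.2 y.2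
  refine ⟨Ψ, c, q, ?_⟩
  filter_upwards [continuousAt_subtype_val.preimage_mem_nhds (Metric.ball_mem_nhds _ hR)] with x hx
  obtain ⟨hψx, hgx⟩ := hΨ ⟨x, hx⟩
  have hzx : z x = x := Subtype.ext (hz x hx)
  have hTx := hT x hx
  rwa [hgx, hψx, hzx] at hTx

end LittleWeightedH

theorem DiscAut.isHolomorphic_derivative (ψ : DiscAut) : IsHolomorphic ψ.derivative :=
  .congr_ext (DifferentiableOn.deriv ψ.holomorphic_toFun Metric.isOpen_ball) fun _ => rfl

end

theorem theorem5p5 :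
    (∃ S : LittleWeightedH discWeight →ₗᵢ[ℂ] LittleWeightedH discWeightSq,
      (∀ (f : LittleWeightedH discWeight) (z : unitDisc), S f z = f (discSq z)) ∧
        ¬ Function.Surjective S) ∧
    ∀ T : LittleWeightedH discWeight →ₗᵢ[ℂ] LittleWeightedH discWeightSq,
      ∃ (c : ℂ) (ψ : DiscAut), ‖c‖ = 1 ∧
        ∀ (f : LittleWeightedH discWeight) (z : unitDisc),
          T f z = c * ψ.derivative z * f (discSq (ψ z)) := by
  refine ⟨⟨compSq, compSq_apply, compSq_not_surjective⟩, fun T => ?_⟩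
  obtain ⟨ψ, c, q, hT⟩ := LittleWeightedH.exists_eventually_transportsEval T
  refine ⟨c, ψ, c.norm_coe, fun f => congrFun ?_⟩
  have hcomp : IsHolomorphic fun z => c * ψ.derivative z * f (discSq (ψ z)) :=
    (ψ.isHolomorphic_derivative.const_mul c).mul ((LittleWeightedH.isHolomorphic f).comp
      (isHolomorphic_discSq.comp ψ.holomorphic_toFun))
  exact (LittleWeightedH.isHolomorphic (T f)).eq_of_eventuallyEq hcomp Metric.isOpen_ball
    (convex_ball 0 1).isPreconnected q (hT.mono fun z hz => hz.apply_eq f)
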